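/- Let $G$ be a finite strongly connected directed graph, possibly with parallel edges and loops, let $s$ be a vertex of $G$, and let $x,y$ be vertices of $G$. Twinless connectivity. Two edges are twins if they are antiparallel, i.e. of the form $(u,v)$ and $(v,u)$. A digraph is twinless strongly connected if it has a strongly connected spanning subgraph without a pair of twin edges; the twinless strongly connected components (TSCCs) of a digraph are its maximal twinless strongly connected subgraphs. A 2-edge twinless strongly connected component (2eTSCC) of a digraph $F$ is a maximal set $C$ of vertices such that any two vertices of $C$ lie in the same TSCC of $F\setminus e$, for every edge $e$ of $F$. Two vertices are 2-edge twinless strongly connected in $F$, written $u\leftrightarrow_{2et}v$ in $F$, if they belong to the same 2eTSCC of $F$. Auxiliary graphs. Regard $G$ as a flow graph $G_s$ with start vertex $s$. A vertex $u$ dominates $v$ if every path from $s$ to $v$ contains $u$. For $v\ne s$, the immediate dominator $d(v)$ is the dominator of $v$ other than $v$ that is dominated by every dominator of $v$ other than $v$; the dominator tree $D(G_s)$ has root $s$, and $d(v)$ is the parent of $v$. Let $D(v)$ be the set of vertices dominated by $v$, so $D(s)=V(G)$. An edge $e=(u,v)$ is a bridge of $G_s$ if every path from $s$ to $v$ uses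 $e$; then $u=d(v)$, and $v$ is called marked. Deleting from $D(G_s)$ the edges that are bridges splits it into rooted trees whose roots are exactly $s$ and the marked vertices; let $T(r)$ be the one with root $r$. For $r=s$ or $r$ marked, $H(G_s,r)$ is the digraph obtained from $G$ by shrinking, for every marked vertex $z$ with $d(z)\in T(r)$, the set $D(z)$ into $z$, and, if $r\neq s$, shrinking $D(s)\setminus D(r)$ into $d(r)$; all edges are kept except self-loops, and whenever several parallel edges result they are replaced by exactly two parallel edges. The vertices in $T(r)$ are called the ordinary vertices of $H(G_s,r)$. Proposition. $x\leftrightarrow_{2et}y$ in $G_s$ if and only if there is a vertex $r$, either $s$ or a marked vertex of $G_s$, such that $x$ and $y$ are both ordinary vertices of $H(G_s,r)$ and $x\leftrightarrow_{2et}y$ in $H(G_s,r)$. -/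

import Mathlib

/-- A directed graph with vertices in `α` and edges in `β`.  Parallel edges and loops are allowed.
The values of `src` and `tgt` outside `edges` carry no meaning. -/
structure MultiDigraph (α β : Type*) where
  verts : Set α
  edges : Set β
  src : β → α
  tgt : β → α
  src_mem : ∀ e ∈ edges, src e ∈ verts
  tgt_mem : ∀ e ∈ edges, tgt e ∈ verts

namespace MultiDigraph

section Connectivity

variable {α β : Type*}

/-- The list of edges `p` leads from `u` to `v`, each edge starting where the previous one ends. -/
def IsWalk (G : MultiDigraph α β) : α → List β → α → Prop
  | u, [], v => u ∈ G.verts ∧ u = v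
  | u, e :: p, v => e ∈ G.edges ∧ G.src e = u ∧ IsWalk G (G.tgt e) p v

/-- A path from `u` to `v`: no edge is used twice; the empty list is the trivial path. -/
def IsPath (G : MultiDigraph α β) (u : α) (p : List β) (v : α) : Prop :=
  G.IsWalk u p v ∧ p.Nodup

/-- The vertex `w` lies on the path with first vertex `u` and edge list `p`. -/
def OnPath (G : MultiDigraph α β) (u : α) (p : List β) (w : α) : Prop :=
  w = u ∨ ∃ e ∈ p, G.tgt e = w

/-- There is a path from each vertex to every other vertex. -/
def StronglyConnected (G : MultiDigraph α β) : Prop :=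
  ∀ u ∈ G.verts, ∀ v ∈ G.verts, ∃ p, G.IsPath u p v

/-- `H` is a subgraph of `G`. -/
def IsSubgraph (H G : MultiDigraph α β) : Prop :=
  H.verts ⊆ G.verts ∧ H.edges ⊆ G.edges ∧
    ∀ e ∈ H.edges, H.src e = G.src e ∧ H.tgt e = G.tgt e

/-- No two edges of `G` are antiparallel. -/
def NoTwins (G : MultiDigraph α β) : Prop :=
  ∀ e ∈ G.edges, ∀ f ∈ G.edges, e ≠ f → ¬ (G.src e = G.tgt f ∧ G.tgt e = G.src f)

/-- `G` has a strongly connected spanning subgraph without twin edges. -/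
def TwinlessStronglyConnected (G : MultiDigraph α β) : Prop :=
  ∃ H : MultiDigraph α β, H.IsSubgraph G ∧ H.verts = G.verts ∧ H.StronglyConnected ∧ H.NoTwins

/-- `C` is a twinless strongly connected component of `G`:
a maximal twinless strongly connected subgraph. -/
def IsTSCC (C G : MultiDigraph α β) : Prop :=
  C.IsSubgraph G ∧ C.TwinlessStronglyConnected ∧
    ∀ D : MultiDigraph α β, D.IsSubgraph G → D.TwinlessStronglyConnected →
      C.IsSubgraph D → D.IsSubgraph C

/-- `u` and `v` belong to the same twinless strongly connected component of `G`. -/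
def SameTSCC (G : MultiDigraph α β) (u v : α) : Prop :=
  ∃ C : MultiDigraph α β, C.IsTSCC G ∧ u ∈ C.verts ∧ v ∈ C.verts

/-- The graph obtained from `G` by deleting the edge `e`. -/
def deleteEdge (G : MultiDigraph α β) (e : β) : MultiDigraph α β where
  verts := G.verts
  edges := G.edges \ {e}
  src := G.src
  tgt := G.tgt
  src_mem := fun f hf => G.src_mem f hf.1
  tgt_mem := fun f hf => G.tgt_mem f hf.1

/-- Any two vertices of `C` are in the same twinless strongly connected component of `G` after
the deletion of any edge. -/
def IsTwoEdgeTwinlessSet (G : MultiDigraph α β) (C : Set α) : Prop :=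
  C ⊆ G.verts ∧ ∀ u ∈ C, ∀ v ∈ C, ∀ e ∈ G.edges, (G.deleteEdge e).SameTSCC u v

/-- `C` is a 2-edge twinless strongly connected component of `G`. -/
def Is2eTSCC (G : MultiDigraph α β) (C : Set α) : Prop :=
  G.IsTwoEdgeTwinlessSet C ∧ ∀ D : Set α, G.IsTwoEdgeTwinlessSet D → C ⊆ D → D ⊆ C

/-- `u` and `v` are 2-edge twinless strongly connected in `G`: they belong to the same
2-edge twinless strongly connected component. -/
def TwoEdgeTwinlessConnected (G : MultiDigraph α β) (u v : α) : Prop :=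
  ∃ C : Set α, G.Is2eTSCC C ∧ u ∈ C ∧ v ∈ C

end Connectivity

section FlowGraph

variable {α β : Type*}

/-- `u` dominates `v` in the flow graph with start vertex `s`. -/
def Dominates (G : MultiDigraph α β) (s u v : α) : Prop :=
  u ∈ G.verts ∧ v ∈ G.verts ∧ ∀ p, G.IsPath s p v → G.OnPath s p u

/-- `d` is the immediate dominator of `x`, that is, the parent of `x` in the dominator tree: a
proper dominator of `x` that is dominated by all proper dominators of `x`. -/
def IsImmDom (G : MultiDigraph α β) (s d x : α) : Prop :=
  (G.Dominates s d x ∧ d ≠ x) ∧ ∀ w, G.Dominates s w x → w ≠ x → G.Dominates s w d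

/-- The vertices of the subtree of the dominator tree rooted at `r`. -/
def domSubtree (G : MultiDigraph α β) (s r : α) : Set α :=
  {v | G.Dominates s r v}

/-- The edge `e` is a bridge of the flow graph with start vertex `s`. -/
def IsBridge (G : MultiDigraph α β) (s : α) (e : β) : Prop :=
  e ∈ G.edges ∧ ∀ p, G.IsPath s p (G.tgt e) → e ∈ p

/-- `y` is the head of a bridge. -/
def Marked (G : MultiDigraph α β) (s y : α) : Prop :=
  ∃ e, G.IsBridge s e ∧ G.tgt e = y

/-- `(a, b)` is an edge of the dominator tree that is not a bridge. -/
def TreeEdge (G : MultiDigraph α β) (s a b : α) : Prop :=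
  G.IsImmDom s a b ∧ ¬ ∃ e, G.IsBridge s e ∧ G.src e = a ∧ G.tgt e = b

/-- The vertices of the tree `T(r)`, with root `r`, in the forest that is obtained from the
dominator tree by removing the bridges. -/
def tree (G : MultiDigraph α β) (s r : α) : Set α :=
  {v | Relation.ReflTransGen (G.TreeEdge s) r v}

/-- `z` is a marked vertex whose immediate dominator lies in `T(r)`. -/
def IsLowerAux (G : MultiDigraph α β) (s r z : α) : Prop :=
  G.Marked s z ∧ ∃ d ∈ G.tree s r, G.IsImmDom s d z

/-- `a` is the vertex of `H(G_s, r)` into which the vertex `v` of `G` is shrunk. -/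
def ShrinksTo (G : MultiDigraph α β) (s r v a : α) : Prop :=
  (v ∈ G.tree s r ∧ a = v) ∨
  (G.IsLowerAux s r a ∧ v ∈ G.domSubtree s a) ∨
  (r ≠ s ∧ v ∈ G.domSubtree s s \ G.domSubtree s r ∧ G.IsImmDom s a r)

/-- The auxiliary graph `H(G_s, r)`.  Edges of `G` whose ends are shrunk into distinct vertices `a`
and `b` become edges from `a` to `b`.  A single edge from `a` to `b` is `(a, b, 0)`; several
parallel ones are converted into the double edge `(a, b, 0)`, `(a, b, 1)`. -/
def auxGraph (G : MultiDigraph α β) (s r : α) : MultiDigraph α (α × α × Fin 2) where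
  verts := G.tree s r ∪ {z | G.IsLowerAux s r z} ∪ {a | r ≠ s ∧ G.IsImmDom s a r}
  edges := {t | t.1 ≠ t.2.1 ∧
    ((t.2.2 : ℕ) : ℕ∞) < {e ∈ G.edges | G.ShrinksTo s r (G.src e) t.1 ∧
      G.ShrinksTo s r (G.tgt e) t.2.1}.encard}
  src := fun t => t.1
  tgt := fun t => t.2.1
  src_mem := by
    rintro t ⟨-, ht⟩
    obtain ⟨e, -, h, -⟩ := Set.encard_pos.mp (pos_of_gt ht)
    rcases h with ⟨hv, h⟩ | ⟨hz, -⟩ | ⟨hr, -, hd⟩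
    · exact Or.inl (Or.inl (h ▸ hv))
    · exact Or.inl (Or.inr hz)
    · exact Or.inr ⟨hr, hd⟩
  tgt_mem := by
    rintro t ⟨-, ht⟩
    obtain ⟨e, -, -, h⟩ := Set.encard_pos.mp (pos_of_gt ht)
    rcases h with ⟨hv, h⟩ | ⟨hz, -⟩ | ⟨hr, -, hd⟩
    · exact Or.inl (Or.inl (h ▸ hv))
    · exact Or.inl (Or.inr hz)
    · exact Or.inr ⟨hr, hd⟩

/-- `v` is an ordinary vertex of `H(G_s, r)`. -/
def OrdinaryIn (G : MultiDigraph α β) (s r v : α) : Prop :=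
  v ∈ G.tree s r

end FlowGraph

end MultiDigraph

/-! Membership in a common TSCC amounts to mutual reachability inside a twin-free edge set
(`sameTSCC_iff`), so both sides become: for every edge, such a set exists that omits it
(`twoEdgeTwinlessConnected_iff`).

The structural fact is that a bridge `e` into a marked vertex `z` is the only edge entering `D(z)`
(`IsBridge.eq_of_enters`). Two vertices separated by some `D(z)` are therefore disconnected in one
direction when `e` is deleted, so connected pairs lie in one tree `T(r)` (`exists_common_tree`). In
`H(G_s, r)` it says that a lower auxiliary vertex `z` is entered only from `d(z)`, and that the
upper one is left only towards `r`, each by one bridge.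

From `G` to `H`: the image of a twin-free set can acquire twins only along these bridges. Dropping
the reverse edges `z → d(z)` and `r → d(r)` removes such twins. No connection between ordinary
vertices is lost: a walk at `z` has already visited `d(z)`, and a walk that goes from `r` to `d(r)`
must come back to `r`.

From `H` to `G`: preimages of a twin-free set are joined, inside each shrunk set, by breadth-first
edges, which contain no twins. Out of `z` they suffice because `D(z)` is entered at `z`; into `d(r)`
they suffice because the complement of `D(r)` is left at `d(r)`. If the deleted edge is inside a
shrunk set, deleting the corresponding bridge in `H` keeps connections from passing through that
vertex (`twinlessLinked_of_auxGraph`). -/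

namespace MultiDigraph

/-! ### Reachability inside an edge set, and twin-free search edges. -/

section Reachability

variable {α β : Type*} {G : MultiDigraph α β} {A B S : Set β} {s u v w : α}

/-- `G.Reach S u v`: there is a walk from `u` to `v` all of whose edges are in `S`. -/
def Reach (G : MultiDigraph α β) (S : Set β) : α → α → Prop :=
  Relation.ReflTransGen fun a b => ∃ f ∈ S, G.src f = a ∧ G.tgt f = b

theorem Reach.refl (G : MultiDigraph α β) (S : Set β) (u : α) : G.Reach S u u :=
  Relation.ReflTransGen.refl

theorem Reach.trans (h : G.Reach S u v) (h' : G.Reach S v w) : G.Reach S u w :=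
  Relation.ReflTransGen.trans h h'

theorem Reach.step {f : β} (h : G.Reach S u (G.src f)) (hf : f ∈ S) : G.Reach S u (G.tgt f) :=
  Relation.ReflTransGen.tail h ⟨f, hf, rfl, rfl⟩

/-- A property that holds at `u` and is preserved along the edges in `S` holds at all vertices
reachable from `u`. -/
theorem Reach.induct {P : α → Prop} (h : G.Reach S u v) (h0 : P u)
    (hstep : ∀ f ∈ S, P (G.src f) → P (G.tgt f)) : P v := by
  induction h with
  | refl => exact h0
  | tail _ hbc ih =>
    obtain ⟨f, hf, rfl, rfl⟩ := hbc
    exact hstep f hf ih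

theorem Reach.mono (h : G.Reach A u v) (hAB : A ⊆ B) : G.Reach B u v :=
  h.induct (P := G.Reach B u) (Reach.refl _ _ _) fun _ hf hu => hu.step (hAB hf)

theorem Reach.mem_verts (h : G.Reach S u v) (hS : S ⊆ G.edges) (hu : u ∈ G.verts) :
    v ∈ G.verts :=
  h.induct hu fun f hf _ => G.tgt_mem f (hS hf)

theorem IsWalk.reach {p : List β} (h : G.IsWalk u p v) (hp : ∀ f ∈ p, f ∈ S) :
    G.Reach S u v := by
  induction p generalizing u with
  | nil => obtain ⟨-, rfl⟩ := h; exact Reach.refl _ _ _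
  | cons e p ih =>
    obtain ⟨-, rfl, h⟩ := h
    exact ((Reach.refl _ _ _).step (hp e (by simp))).trans
      (ih h fun f hf => hp f (List.mem_cons_of_mem _ hf))

theorem IsWalk.mem_edges {p : List β} (h : G.IsWalk u p v) : ∀ f ∈ p, f ∈ G.edges := by
  induction p generalizing u with
  | nil => simp
  | cons e p ih =>
    obtain ⟨he, -, h⟩ := h
    simpa using ⟨he, ih h⟩

theorem IsWalk.drop {p q : List β} {f : β} (h : G.IsWalk u (p ++ f :: q) v) :
    G.IsWalk (G.src f) (f :: q) v := by
  induction p generalizing u with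
  | nil => obtain ⟨h1, -, h2⟩ := h; exact ⟨h1, rfl, h2⟩
  | cons e p ih => exact ih h.2.2

theorem Reach.exists_path (h : G.Reach S u v) (hS : S ⊆ G.edges) (hu : u ∈ G.verts) :
    ∃ p, G.IsPath u p v ∧ ∀ f ∈ p, f ∈ S := by
  have hv := h.mem_verts hS hu
  clear hu
  induction h using Relation.ReflTransGen.head_induction_on with
  | refl => exact ⟨[], ⟨⟨hv, rfl⟩, List.nodup_nil⟩, by simp⟩
  | head hac _ ih =>
    obtain ⟨f, hf, rfl, rfl⟩ := hac
    obtain ⟨p, ⟨hw, hn⟩, hp⟩ := ih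
    -- If `f` recurs, the walk is shortened to start at that later occurrence.
    by_cases hfp : f ∈ p
    · obtain ⟨p₁, p₂, rfl⟩ := List.append_of_mem hfp
      exact ⟨f :: p₂, ⟨hw.drop, (List.nodup_append.mp hn).2.1⟩,
        fun g hg => hp g (List.mem_append_right _ hg)⟩
    · exact ⟨f :: p, ⟨⟨hS hf, rfl, hw⟩, List.nodup_cons.mpr ⟨hfp, hn⟩⟩, by simpa using ⟨hf, hp⟩⟩

theorem StronglyConnected.reach (hG : G.StronglyConnected) (hu : u ∈ G.verts) (hv : v ∈ G.verts) :
    G.Reach G.edges u v := by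
  obtain ⟨p, hp, -⟩ := hG u hu v hv
  exact hp.reach hp.mem_edges

/-- The graph obtained by reversing all edges. -/
def rev (G : MultiDigraph α β) : MultiDigraph α β where
  verts := G.verts
  edges := G.edges
  src := G.tgt
  tgt := G.src
  src_mem := G.tgt_mem
  tgt_mem := G.src_mem

theorem Reach.rev (h : G.Reach S u v) : G.rev.Reach S v u := by
  induction h with
  | refl => exact Reach.refl _ _ _
  | tail _ hbc ih =>
    obtain ⟨f, hf, rfl, rfl⟩ := hbc
    exact Relation.ReflTransGen.head ⟨f, hf, rfl, rfl⟩ ih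

/-- No two edges in `S` are antiparallel. -/
def TwinFree (G : MultiDigraph α β) (S : Set β) : Prop :=
  ∀ e ∈ S, ∀ f ∈ S, e ≠ f → ¬ (G.src e = G.tgt f ∧ G.tgt e = G.src f)

theorem TwinFree.rev (h : G.rev.TwinFree S) : G.TwinFree S :=
  fun e he f hf hef ⟨h1, h2⟩ => h e he f hf hef ⟨h2, h1⟩

/-- The vertices that can be reached from `z` in exactly `n` steps along edges in `A`. -/
def layer (G : MultiDigraph α β) (A : Set β) (z : α) : ℕ → Set α
  | 0 => {z}
  | n + 1 => {w | ∃ f ∈ A, G.src f ∈ layer G A z n ∧ G.tgt f = w}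

/-- The breadth-first search edges: a twin-free subset of `A` with the same reachability
from `z`. -/
theorem exists_twinFree_reach (G : MultiDigraph α β) (A : Set β) (z : α) :
    ∃ B ⊆ A, G.TwinFree B ∧ ∀ w, G.Reach A z w → G.Reach B z w := by
  set level : α → ℕ := fun w => sInf {n | w ∈ G.layer A z n}
  -- Kept edges raise the level by exactly one, which antiparallel edges cannot both do. The
  -- argument is purely arithmetic, so the default level `0` of unreachable vertices is harmless.
  refine ⟨{f ∈ A | level (G.tgt f) = level (G.src f) + 1}, fun f hf => hf.1, ?_, ?_⟩
  · rintro e ⟨-, he⟩ f ⟨-, hf⟩ - ⟨h1, h2⟩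
    rw [h1, h2] at he
    omega
  · have key : ∀ n w, w ∈ G.layer A z n → level w = n →
        G.Reach {f ∈ A | level (G.tgt f) = level (G.src f) + 1} z w := by
      intro n
      induction n with
      | zero => rintro w rfl -; exact Reach.refl _ _ _
      | succ n ih =>
        rintro _ ⟨f, hf, hsrc, rfl⟩ hl
        have h1 : level (G.src f) ≤ n := Nat.sInf_le hsrc
        have h2 : G.src f ∈ G.layer A z (level (G.src f)) :=
          Nat.sInf_mem (s := {n | G.src f ∈ G.layer A z n}) ⟨n, hsrc⟩
        have h3 : level (G.tgt f) ≤ level (G.src f) + 1 := Nat.sInf_le ⟨f, hf, h2, rfl⟩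
        have h4 : level (G.src f) = n := by omega
        exact (ih _ hsrc h4).step ⟨hf, by omega⟩
    intro w hw
    have hne : ∃ n, w ∈ G.layer A z n :=
      hw.induct (P := fun w => ∃ n, w ∈ G.layer A z n) ⟨0, rfl⟩
        fun f hf ⟨n, hn⟩ => ⟨n + 1, f, hf, hn, rfl⟩
    exact key _ w (Nat.sInf_mem (s := {n | w ∈ G.layer A z n}) hne) rfl

end Reachability

/-! ### Twinless components as twin-free mutual reachability. -/

section Twinless

variable {α β : Type*} {G : MultiDigraph α β} {S : Set β} {x y : α}

theorem IsSubgraph.refl (G : MultiDigraph α β) : G.IsSubgraph G :=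
  ⟨subset_rfl, subset_rfl, fun _ _ => ⟨rfl, rfl⟩⟩

theorem IsSubgraph.trans {K H : MultiDigraph α β} (h : K.IsSubgraph H) (h' : H.IsSubgraph G) :
    K.IsSubgraph G :=
  ⟨h.1.trans h'.1, h.2.1.trans h'.2.1, fun e he =>
    ⟨(h.2.2 e he).1.trans (h'.2.2 e (h.2.1 he)).1,
      (h.2.2 e he).2.trans (h'.2.2 e (h.2.1 he)).2⟩⟩

theorem IsSubgraph.reach {H : MultiDigraph α β} (h : H.IsSubgraph G) (hS : S ⊆ H.edges)
    (hxy : H.Reach S x y) : G.Reach S x y := by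
  induction hxy with
  | refl => exact Reach.refl _ _ _
  | tail _ hbc ih =>
    obtain ⟨f, hf, rfl, rfl⟩ := hbc
    rw [(h.2.2 f (hS hf)).1] at ih
    rw [(h.2.2 f (hS hf)).2]
    exact ih.step hf

/-- `x` and `y` lie on a common closed walk that uses no pair of twins and only edges in `A`. -/
def TwinlessLinked (G : MultiDigraph α β) (A : Set β) (x y : α) : Prop :=
  ∃ S ⊆ A, G.TwinFree S ∧ G.Reach S x y ∧ G.Reach S y x

/-- By finiteness, a candidate with the fewest missing vertices and edges exists. Endpoints of
non-edges are arbitrary, so maximality is only up to mutual `IsSubgraph`. -/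
theorem TwinlessStronglyConnected.exists_isTSCC (hV : G.verts.Finite) (hE : G.edges.Finite)
    {D : MultiDigraph α β} (hD : D.IsSubgraph G) (hT : D.TwinlessStronglyConnected) :
    ∃ C : MultiDigraph α β, C.IsTSCC G ∧ D.IsSubgraph C := by
  obtain ⟨C, ⟨hCG, hCT, hDC⟩, hmax⟩ := WellFounded.has_min
    (measure fun C : MultiDigraph α β =>
      (G.verts.ncard - C.verts.ncard) + (G.edges.ncard - C.edges.ncard)).wf
    {C | C.IsSubgraph G ∧ C.TwinlessStronglyConnected ∧ D.IsSubgraph C}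
    ⟨D, hD, hT, IsSubgraph.refl _⟩
  refine ⟨C, ⟨hCG, hCT, fun K hKG hKT hCK => ?_⟩, hDC⟩
  have h : ¬ ((G.verts.ncard - K.verts.ncard) + (G.edges.ncard - K.edges.ncard) <
      (G.verts.ncard - C.verts.ncard) + (G.edges.ncard - C.edges.ncard)) :=
    hmax K ⟨hKG, hKT, hDC.trans hCK⟩
  have hKV := hV.subset hKG.1
  have hKE := hE.subset hKG.2.1
  have h1 := Set.ncard_le_ncard hCK.1 hKV
  have h2 := Set.ncard_le_ncard hCK.2.1 hKE
  have h3 := Set.ncard_le_ncard hKG.1 hV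
  have h4 := Set.ncard_le_ncard hKG.2.1 hE
  have hv : C.verts = K.verts := Set.eq_of_subset_of_ncard_le hCK.1 (by omega) hKV
  have he : C.edges = K.edges := Set.eq_of_subset_of_ncard_le hCK.2.1 (by omega) hKE
  exact ⟨hv.ge, he.ge, fun e hek =>
    ⟨((hCK.2.2 e (he.ge hek)).1).symm, ((hCK.2.2 e (he.ge hek)).2).symm⟩⟩

theorem sameTSCC_iff (hV : G.verts.Finite) (hE : G.edges.Finite) :
    G.SameTSCC x y ↔ x ∈ G.verts ∧ y ∈ G.verts ∧ G.TwinlessLinked G.edges x y := by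
  constructor
  · rintro ⟨C, ⟨hCG, ⟨H, hHC, hHV, hHS, hHT⟩, -⟩, hx, hy⟩
    have hHG := hHC.trans hCG
    refine ⟨hCG.1 hx, hCG.1 hy, H.edges, hHG.2.1, fun e he f hf hef => ?_, ?_, ?_⟩
    · rw [← (hHG.2.2 e he).1, ← (hHG.2.2 e he).2, ← (hHG.2.2 f hf).1, ← (hHG.2.2 f hf).2]
      exact hHT e he f hf hef
    · exact hHG.reach subset_rfl (hHS.reach (hHV ▸ hx) (hHV ▸ hy))
    · exact hHG.reach subset_rfl (hHS.reach (hHV ▸ hy) (hHV ▸ hx))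
  · rintro ⟨hx, hy, S, hS, hT, hxy, hyx⟩
    -- `D` is the strongly connected component of `x` in the graph with edge set `S`; walks between
    -- its vertices stay inside it.
    let D : MultiDigraph α β :=
      { verts := {w | G.Reach S x w ∧ G.Reach S w x}
        edges := {f ∈ S | (G.Reach S x (G.src f) ∧ G.Reach S (G.src f) x) ∧
          (G.Reach S x (G.tgt f) ∧ G.Reach S (G.tgt f) x)}
        src := G.src
        tgt := G.tgt
        src_mem := fun f hf => hf.2.1
        tgt_mem := fun f hf => hf.2.2 }
    have hDG : D.IsSubgraph G :=
      ⟨fun w hw => hw.1.mem_verts hS hx, fun f hf => hS hf.1, fun _ _ => ⟨rfl, rfl⟩⟩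
    have hconn : D.StronglyConnected := by
      intro u hu v hv
      have huv : G.Reach S u v := hu.2.trans hv.1
      have hD : D.Reach D.edges u v := by
        have hvx := hv.2
        clear hv
        induction huv with
        | refl => exact Reach.refl _ _ _
        | tail hub hbc ih =>
          obtain ⟨f, hf, rfl, rfl⟩ := hbc
          have hb : G.Reach S (G.src f) x := ((Reach.refl _ _ _).step hf).trans hvx
          exact Reach.step (G := D) (ih hb)
            ⟨hf, ⟨hu.1.trans hub, hb⟩, (hu.1.trans hub).step hf, hvx⟩
      obtain ⟨p, hp, -⟩ := hD.exists_path subset_rfl hu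
      exact ⟨p, hp⟩
    obtain ⟨C, hC, hDC⟩ := TwinlessStronglyConnected.exists_isTSCC hV hE hDG
      ⟨D, IsSubgraph.refl _, rfl, hconn, fun e he f hf => hT e he.1 f hf.1⟩
    exact ⟨C, hC, hDC.1 ⟨Reach.refl _ _ _, Reach.refl _ _ _⟩, hDC.1 ⟨hxy, hyx⟩⟩

/-- The pair `{x, y}` already satisfies the defining condition and extends to a maximal set, so
transitivity of the relation is not needed. -/
theorem twoEdgeTwinlessConnected_iff (hV : G.verts.Finite) (hE : G.edges.Finite) :
    G.TwoEdgeTwinlessConnected x y ↔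
      x ∈ G.verts ∧ y ∈ G.verts ∧ ∀ e ∈ G.edges, G.TwinlessLinked (G.edges \ {e}) x y := by
  have hiff : ∀ e, (G.deleteEdge e).SameTSCC x y ↔
      x ∈ G.verts ∧ y ∈ G.verts ∧ G.TwinlessLinked (G.edges \ {e}) x y :=
    fun e => sameTSCC_iff (G := G.deleteEdge e) hV (hE.subset Set.sdiff_subset)
  constructor
  · rintro ⟨C, ⟨⟨hC, h⟩, -⟩, hx, hy⟩
    exact ⟨hC hx, hC hy, fun e he => ((hiff e).mp (h x hx y hy e he)).2.2⟩
  · rintro ⟨hx, hy, h⟩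
    have hset : G.IsTwoEdgeTwinlessSet {x, y} := by
      refine ⟨Set.insert_subset hx (Set.singleton_subset_iff.mpr hy), ?_⟩
      intro u hu v hv e he
      obtain ⟨C, hC, hxC, hyC⟩ := (hiff e).mpr ⟨hx, hy, h e he⟩
      refine ⟨C, hC, ?_, ?_⟩
      · rcases hu with rfl | rfl <;> assumption
      · rcases hv with rfl | rfl <;> assumption
    obtain ⟨C, hle, hmax⟩ := (hV.finite_subsets.subset
      (fun D hD => hD.1 : {D | G.IsTwoEdgeTwinlessSet D} ⊆ {D | D ⊆ G.verts})).exists_le_maximal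
      hset
    exact ⟨C, ⟨hmax.prop, fun D hD hCD => hmax.le_of_ge hD hCD⟩, hle (by simp), hle (by simp)⟩

end Twinless

end MultiDigraph
namespace MultiDigraph

/-! ### The dominator tree and its bridges. -/

section Dominators

variable {α β : Type*} {G : MultiDigraph α β} {S : Set β} {s d r u v w z : α} {e f : β}

/-- The edges of `G` that do not enter `u`. -/
def avoiding (G : MultiDigraph α β) (u : α) : Set β := {f ∈ G.edges | G.tgt f ≠ u}

theorem avoiding_subset : G.avoiding u ⊆ G.edges := fun _ hf => hf.1

theorem dominates_iff (hs : s ∈ G.verts) :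
    G.Dominates s u v ↔
      u ∈ G.verts ∧ v ∈ G.verts ∧ (u = s ∨ ¬ G.Reach (G.avoiding u) s v) := by
  refine and_congr_right fun _ => and_congr_right fun _ => ⟨fun h => ?_, fun h p hp => ?_⟩
  · by_contra! hc
    obtain ⟨p, hp, hpa⟩ := hc.2.exists_path avoiding_subset hs
    rcases h p hp with rfl | ⟨e, he, rfl⟩
    · exact hc.1 rfl
    · exact (hpa e he).2 rfl
  · rcases h with rfl | h
    · exact Or.inl rfl
    · by_contra hc
      exact h (hp.1.reach fun f hf =>
        ⟨hp.1.mem_edges f hf, fun hfu => hc (Or.inr ⟨f, hf, hfu⟩)⟩)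

theorem Dominates.not_reach (hs : s ∈ G.verts) (h : G.Dominates s u v) (hu : u ≠ s) :
    ¬ G.Reach (G.avoiding u) s v :=
  ((dominates_iff hs).mp h).2.2.resolve_left hu

theorem ne_and_reach_of_not_dominates (hs : s ∈ G.verts) (hu : u ∈ G.verts) (hv : v ∈ G.verts)
    (h : ¬ G.Dominates s u v) : u ≠ s ∧ G.Reach (G.avoiding u) s v := by
  by_contra hc
  exact h ((dominates_iff hs).mpr ⟨hu, hv, by tauto⟩)

theorem dominates_root (hs : s ∈ G.verts) (hv : v ∈ G.verts) : G.Dominates s s v :=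
  (dominates_iff hs).mpr ⟨hs, hv, Or.inl rfl⟩

theorem Dominates.eq_root (h : G.Dominates s u s) : u = s := by
  rcases h.2.2 [] ⟨⟨h.2.1, rfl⟩, List.nodup_nil⟩ with h | ⟨e, he, -⟩
  · exact h
  · simp at he

theorem dominates_refl (hv : v ∈ G.verts) : G.Dominates s v v := by
  refine ⟨hv, hv, fun p ⟨hp, _⟩ => ?_⟩
  by_cases h : G.OnPath s p v
  · exact h
  · exfalso
    have hr : G.Reach {f | f ∈ p} s v := hp.reach fun f hf => hf
    exact hr.induct (P := fun w => w ≠ v) (fun h' => h (Or.inl h'.symm))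
      (fun f hf _ h' => h (Or.inr ⟨f, hf, h'⟩)) rfl

theorem Dominates.trans (hs : s ∈ G.verts) (huv : G.Dominates s u v) (hvw : G.Dominates s v w) :
    G.Dominates s u w := by
  by_contra hc
  obtain ⟨hus, hr⟩ := ne_and_reach_of_not_dominates hs huv.1 hvw.2.1 hc
  by_cases hvs : v = s
  · subst hvs
    exact hus huv.eq_root
  · refine hvw.not_reach hs hvs ((hr.induct
      (P := fun x => G.Reach (G.avoiding u) s x ∧ G.Reach (G.avoiding v) s x)
      ⟨Reach.refl _ _ _, Reach.refl _ _ _⟩ fun f hf ⟨h1, h2⟩ => ?_).2)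
    refine ⟨h1.step hf, h2.step ⟨hf.1, fun hfv => ?_⟩⟩
    exact huv.not_reach hs hus (hfv ▸ h1.step hf)

/-- A walk from `s` can reach neither of two distinct, mutually dominating vertices first. -/
theorem Dominates.antisymm (hs : s ∈ G.verts) (hG : G.StronglyConnected)
    (huv : G.Dominates s u v) (hvu : G.Dominates s v u) : u = v := by
  by_contra hne
  have hus : u ≠ s := by
    rintro rfl
    exact hne hvu.eq_root.symm
  have hvs : v ≠ s := by
    rintro rfl
    exact hne huv.eq_root
  refine huv.not_reach hs hus (((hG.reach hs huv.2.1).induct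
    (P := fun x => G.Reach (G.avoiding u) s x ∧ G.Reach (G.avoiding v) s x)
    ⟨Reach.refl _ _ _, Reach.refl _ _ _⟩ fun f hf ⟨h1, h2⟩ => ?_).1)
  have hfu : G.tgt f ≠ u := by
    intro h
    exact hvu.not_reach hs hvs (h ▸ h2.step ⟨hf, h ▸ hne⟩)
  have hfv : G.tgt f ≠ v := by
    intro h
    exact huv.not_reach hs hus (h ▸ h1.step ⟨hf, hfu⟩)
  exact ⟨h1.step ⟨hf, hfu⟩, h2.step ⟨hf, hfv⟩⟩

/-- Otherwise `v` is reachable avoiding `u` and `u` avoiding `v`. Along a walk to `w`, each arrival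
at one of them is replaced by a detour avoiding the other, so `w` is reached avoiding `u` or
avoiding `v`. -/
theorem Dominates.total (hs : s ∈ G.verts) (hG : G.StronglyConnected)
    (hu : G.Dominates s u w) (hv : G.Dominates s v w) :
    G.Dominates s u v ∨ G.Dominates s v u := by
  by_contra! hc
  obtain ⟨hus, hr1⟩ := ne_and_reach_of_not_dominates hs hu.1 hv.1 hc.1
  obtain ⟨hvs, hr2⟩ := ne_and_reach_of_not_dominates hs hv.1 hu.1 hc.2
  have key : G.Reach (G.avoiding u) s w ∨ G.Reach (G.avoiding v) s w := by
    refine (hG.reach hs hu.2.1).induct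
      (P := fun x => G.Reach (G.avoiding u) s x ∨ G.Reach (G.avoiding v) s x)
      (Or.inl (Reach.refl _ _ _)) fun f hf h => ?_
    rcases h with h | h
    · by_cases hfu : G.tgt f = u
      · exact Or.inr (hfu ▸ hr2)
      · exact Or.inl (h.step ⟨hf, hfu⟩)
    · by_cases hfv : G.tgt f = v
      · exact Or.inl (hfv ▸ hr1)
      · exact Or.inr (h.step ⟨hf, hfv⟩)
  exact key.elim (hu.not_reach hs hus) (hv.not_reach hs hvs)

theorem tgt_eq_of_enters (hs : s ∈ G.verts) (hz : z ∈ G.verts) (hf : f ∈ G.edges)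
    (h1 : ¬ G.Dominates s z (G.src f)) (h2 : G.Dominates s z (G.tgt f)) : G.tgt f = z := by
  by_contra hne
  obtain ⟨hzs, hr⟩ := ne_and_reach_of_not_dominates hs hz (G.src_mem f hf) h1
  exact h2.not_reach hs hzs (hr.step ⟨hf, hne⟩)

theorem dominators_ncard_lt (hV : G.verts.Finite) (hs : s ∈ G.verts) (hG : G.StronglyConnected)
    (h : G.Dominates s u v) (hne : u ≠ v) :
    {w | G.Dominates s w u}.ncard < {w | G.Dominates s w v}.ncard := by
  refine Set.ncard_lt_ncard ⟨fun w hw => Dominates.trans hs hw h, fun hsub => ?_⟩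
    (hV.subset fun w hw => hw.1)
  exact hne (h.antisymm hs hG (hsub (dominates_refl h.2.1)))

theorem exists_isImmDom (hV : G.verts.Finite) (hs : s ∈ G.verts) (hG : G.StronglyConnected)
    (hv : v ∈ G.verts) (hvs : v ≠ s) : ∃ d, G.IsImmDom s d v := by
  -- The deepest proper dominator, depth being the number of dominators.
  obtain ⟨d, hd, hmax⟩ := Set.exists_max_image {u | G.Dominates s u v ∧ u ≠ v}
    (fun u => {w | G.Dominates s w u}.ncard) (hV.subset fun w hw => hw.1.1)
    ⟨s, dominates_root hs hv, hvs.symm⟩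
  refine ⟨d, hd, fun w hw hwv => ?_⟩
  rcases hw.total hs hG hd.1 with h | h
  · exact h
  · by_cases hdw : d = w
    · subst hdw; exact h
    · exact absurd (dominators_ncard_lt hV hs hG h hdw) (not_lt.mpr (hmax w ⟨hw, hwv⟩))

theorem IsImmDom.unique {d' : α} (hs : s ∈ G.verts) (hG : G.StronglyConnected)
    (h : G.IsImmDom s d v) (h' : G.IsImmDom s d' v) : d = d' :=
  (h'.2 d h.1.1 h.1.2).antisymm hs hG (h.2 d' h'.1.1 h'.1.2)

/-- Induction along the dominator tree. -/
theorem dominator_induction (hV : G.verts.Finite) (hs : s ∈ G.verts) (hG : G.StronglyConnected)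
    {P : α → Prop} (h0 : P s) (hstep : ∀ d v, G.IsImmDom s d v → P d → P v)
    (hv : v ∈ G.verts) : P v := by
  induction hn : {w | G.Dominates s w v}.ncard using Nat.strong_induction_on generalizing v with
  | _ n ih =>
    by_cases hvs : v = s
    · exact hvs ▸ h0
    · obtain ⟨d, hd⟩ := exists_isImmDom hV hs hG hv hvs
      exact hstep d v hd (ih _ (hn ▸ dominators_ncard_lt hV hs hG hd.1.1 hd.1.2) hd.1.1.1 rfl)

theorem IsBridge.not_reach (hs : s ∈ G.verts) (he : G.IsBridge s e) :
    ¬ G.Reach (G.edges \ {e}) s (G.tgt e) := by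
  intro h
  obtain ⟨p, hp, hpe⟩ := h.exists_path Set.sdiff_subset hs
  exact (hpe e (he.2 p hp)).2 rfl

theorem IsBridge.isImmDom (hs : s ∈ G.verts) (hG : G.StronglyConnected) (he : G.IsBridge s e) :
    G.IsImmDom s (G.src e) (G.tgt e) := by
  refine ⟨⟨?_, fun hloop => ?_⟩, fun w hw hwv => ?_⟩
  · by_contra hc
    obtain ⟨hus, hr⟩ := ne_and_reach_of_not_dominates hs (G.src_mem e he.1) (G.tgt_mem e he.1) hc
    refine he.not_reach hs ((hr.induct
      (P := fun x => x ≠ G.src e ∧ G.Reach (G.edges \ {e}) s x)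
      ⟨hus.symm, Reach.refl _ _ _⟩ fun f hf ⟨h1, h2⟩ => ?_).2)
    refine ⟨hf.2, h2.step ⟨hf.1, ?_⟩⟩
    rintro rfl
    exact h1 rfl
  · refine he.not_reach hs ((hG.reach hs (G.tgt_mem e he.1)).induct (Reach.refl _ _ _)
      fun f hf h => ?_)
    by_cases hfe : f = e
    · subst hfe
      exact hloop ▸ h
    · exact h.step ⟨hf, hfe⟩
  · by_contra hc
    obtain ⟨hws, hr⟩ := ne_and_reach_of_not_dominates hs hw.1 (G.src_mem e he.1) hc
    exact hw.not_reach hs hws (hr.step ⟨he.1, hwv.symm⟩)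

/-- The tail of `f` is reachable without entering the head of `e`, hence without using `e`; a second
edge into that head would then bypass the bridge. -/
theorem IsBridge.eq_of_enters (hs : s ∈ G.verts) (he : G.IsBridge s e) (hf : f ∈ G.edges)
    (h1 : ¬ G.Dominates s (G.tgt e) (G.src f)) (h2 : G.Dominates s (G.tgt e) (G.tgt f)) :
    f = e := by
  have hft := tgt_eq_of_enters hs h2.1 hf h1 h2
  obtain ⟨-, hr⟩ := ne_and_reach_of_not_dominates hs h2.1 (G.src_mem f hf) h1
  by_contra hne
  refine he.not_reach hs (hft ▸ Reach.step (f := f) (hr.mono ?_) ⟨hf, hne⟩)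
  rintro g ⟨hg, hge⟩
  refine ⟨hg, ?_⟩
  rintro rfl
  exact hge rfl

theorem IsBridge.not_dominates_of_reach (hs : s ∈ G.verts) (he : G.IsBridge s e)
    (hS : S ⊆ G.edges \ {e}) (h : G.Reach S u v) (hu : ¬ G.Dominates s (G.tgt e) u) :
    ¬ G.Dominates s (G.tgt e) v :=
  h.induct (P := fun x => ¬ G.Dominates s (G.tgt e) x) hu fun _ hf h1 h2 =>
    (hS hf).2 (he.eq_of_enters hs (hS hf).1 h1 h2)

/-- Inside the subtree of `z`, all vertices can be reached from `z`. -/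
theorem reach_in_domSubtree (hs : s ∈ G.verts) (hG : G.StronglyConnected)
    (h : G.Dominates s z v) :
    G.Reach {f ∈ G.edges | G.Dominates s z (G.src f) ∧ G.Dominates s z (G.tgt f)} z v := by
  refine (hG.reach hs h.2.1).induct (P := fun v => G.Dominates s z v →
    G.Reach {f ∈ G.edges | G.Dominates s z (G.src f) ∧ G.Dominates s z (G.tgt f)} z v)
    (fun h => ?_) (fun f hf ih h2 => ?_) h
  · rw [h.eq_root]
    exact Reach.refl _ _ _
  · by_cases h1 : G.Dominates s z (G.src f)
    · exact (ih h1).step ⟨hf, h1, h2⟩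
    · rw [tgt_eq_of_enters hs h.1 hf h1 h2]
      exact Reach.refl _ _ _

/-- Outside the subtree of a marked vertex, the tail of the bridge can be reached from all
vertices. -/
theorem IsBridge.reach_src (hs : s ∈ G.verts) (hG : G.StronglyConnected) (he : G.IsBridge s e)
    (hv : v ∈ G.verts) (h : ¬ G.Dominates s (G.tgt e) v) :
    G.Reach {f ∈ G.edges | ¬ G.Dominates s (G.tgt e) (G.src f) ∧
      ¬ G.Dominates s (G.tgt e) (G.tgt f)} v (G.src e) := by
  set A := {f ∈ G.edges | ¬ G.Dominates s (G.tgt e) (G.src f) ∧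
      ¬ G.Dominates s (G.tgt e) (G.tgt f)}
  have key : G.Reach A v (G.src e) ∨
      (¬ G.Dominates s (G.tgt e) (G.tgt e) ∧ G.Reach A v (G.tgt e)) := by
    -- A walk from `v` to the head of `e` is followed until it first enters the subtree. The
    -- entering edge is the bridge, so its tail has been reached outside.
    refine (hG.reach hv (G.tgt_mem e he.1)).induct
      (P := fun x => G.Reach A v (G.src e) ∨ (¬ G.Dominates s (G.tgt e) x ∧ G.Reach A v x))
      (Or.inr ⟨h, Reach.refl _ _ _⟩) fun f hf ih => ?_
    rcases ih with ih | ⟨h1, ih⟩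
    · exact Or.inl ih
    · by_cases h2 : G.Dominates s (G.tgt e) (G.tgt f)
      · left
        rw [he.eq_of_enters hs hf h1 h2] at ih
        exact ih
      · exact Or.inr ⟨h2, ih.step ⟨hf, h1, h2⟩⟩
  exact key.resolve_right fun h => h.1 (dominates_refl (G.tgt_mem e he.1))

end Dominators

/-! ### The partition of the vertices by shrinking. -/

section Shrinking

variable {α β : Type*} {G : MultiDigraph α β} {S : Set β} {s d r u v w a b z : α} {e f : β}

theorem dominates_of_mem_tree (hs : s ∈ G.verts) (hr : r ∈ G.verts) (hv : v ∈ G.tree s r) :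
    G.Dominates s r v := by
  induction hv with
  | refl => exact dominates_refl hr
  | tail _ h ih => exact ih.trans hs h.1.1.1

/-- Going down a tree, `D(z)` could only be entered at `z` itself, but the dominator tree edge into
`z` is a bridge and has been removed. -/
theorem not_dominates_of_mem_tree (hs : s ∈ G.verts) (hG : G.StronglyConnected)
    (hz : G.Marked s z) (hzr : ¬ G.Dominates s z r) (hv : v ∈ G.tree s r) :
    ¬ G.Dominates s z v := by
  induction hv with
  | refl => exact hzr
  | @tail a b _ h ih =>
    intro hzb
    by_cases hne : z = b
    · subst hne
      obtain ⟨e, he, rfl⟩ := hz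
      exact h.2 ⟨e, he, (he.isImmDom hs hG).unique hs hG h.1, rfl⟩
    · exact ih (h.1.2 z hzb hne)

theorem mem_tree_or_dominates (hV : G.verts.Finite) (hs : s ∈ G.verts) (hG : G.StronglyConnected)
    (hv : G.Dominates s r v) :
    v ∈ G.tree s r ∨ ∃ z, G.IsLowerAux s r z ∧ G.Dominates s z v := by
  refine dominator_induction (P := fun v => G.Dominates s r v → v ∈ G.tree s r ∨
    ∃ z, G.IsLowerAux s r z ∧ G.Dominates s z v) hV hs hG (fun h => ?_)
    (fun d v hd ih h => ?_) hv.2.1 hv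
  · rw [h.eq_root]
    exact Or.inl Relation.ReflTransGen.refl
  · by_cases hrv : r = v
    · subst hrv
      exact Or.inl Relation.ReflTransGen.refl
    · rcases ih (hd.2 r h hrv) with ht | ⟨z, hz, hzd⟩
      · by_cases hb : ∃ e, G.IsBridge s e ∧ G.src e = d ∧ G.tgt e = v
        · obtain ⟨e, he, -, hev⟩ := hb
          exact Or.inr ⟨v, ⟨⟨e, he, hev⟩, d, ht, hd⟩, dominates_refl h.2.1⟩
        · exact Or.inl (Relation.ReflTransGen.tail ht ⟨hd, hb⟩)
      · exact Or.inr ⟨z, hz, hzd.trans hs hd.1.1⟩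

theorem exists_mem_tree (hV : G.verts.Finite) (hs : s ∈ G.verts) (hG : G.StronglyConnected)
    (hv : v ∈ G.verts) : ∃ r ∈ G.verts, (r = s ∨ G.Marked s r) ∧ v ∈ G.tree s r := by
  refine dominator_induction (P := fun v => ∃ r ∈ G.verts, (r = s ∨ G.Marked s r) ∧
    v ∈ G.tree s r) hV hs hG ⟨s, hs, Or.inl rfl, Relation.ReflTransGen.refl⟩ ?_ hv
  rintro d v hd ⟨r, hrV, hr, hdr⟩
  by_cases hb : ∃ e, G.IsBridge s e ∧ G.src e = d ∧ G.tgt e = v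
  · obtain ⟨e, he, -, hev⟩ := hb
    exact ⟨v, hd.1.1.2.1, Or.inr ⟨e, he, hev⟩, Relation.ReflTransGen.refl⟩
  · exact ⟨r, hrV, hr, Relation.ReflTransGen.tail hdr ⟨hd, hb⟩⟩

/-- `a` is the vertex of `H(G_s, r)` that represents the vertices outside the subtree of `r`. -/
def IsUpperAux (G : MultiDigraph α β) (s r a : α) : Prop := r ≠ s ∧ G.IsImmDom s a r

theorem IsLowerAux.exists_bridge (hs : s ∈ G.verts) (hG : G.StronglyConnected)
    (hz : G.IsLowerAux s r z) : ∃ e, G.IsBridge s e ∧ G.tgt e = z ∧ G.src e ∈ G.tree s r := by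
  obtain ⟨⟨e, he, rfl⟩, d, hd, hdz⟩ := hz
  exact ⟨e, he, rfl, (he.isImmDom hs hG).unique hs hG hdz ▸ hd⟩

theorem IsLowerAux.dominates (hs : s ∈ G.verts) (hr : r ∈ G.verts) (hz : G.IsLowerAux s r z) :
    G.Dominates s r z := by
  obtain ⟨-, d, hd, hdz⟩ := hz
  exact (dominates_of_mem_tree hs hr hd).trans hs hdz.1.1

theorem IsLowerAux.not_dominates_root (hs : s ∈ G.verts) (hG : G.StronglyConnected)
    (hr : r ∈ G.verts) (hz : G.IsLowerAux s r z) : ¬ G.Dominates s z r := by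
  obtain ⟨-, d, hd, hdz⟩ := hz
  intro h
  have hd' := dominates_of_mem_tree hs hr hd
  exact hdz.1.2 (hdz.1.1.antisymm hs hG (h.trans hs hd'))

theorem IsLowerAux.not_dominates (hs : s ∈ G.verts) (hG : G.StronglyConnected)
    (hr : r ∈ G.verts) (hz : G.IsLowerAux s r z) (hv : v ∈ G.tree s r) : ¬ G.Dominates s z v :=
  not_dominates_of_mem_tree hs hG hz.1 (hz.not_dominates_root hs hG hr) hv

theorem IsLowerAux.eq_of_dominates (hs : s ∈ G.verts) (hG : G.StronglyConnected)
    (hr : r ∈ G.verts) (hz : G.IsLowerAux s r z) (hw : G.IsLowerAux s r w)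
    (h : G.Dominates s z w) : z = w := by
  by_contra hne
  obtain ⟨-, d, hd, hdw⟩ := hw
  exact hz.not_dominates hs hG hr hd (hdw.2 z h hne)

theorem IsUpperAux.not_dominates (hs : s ∈ G.verts) (hG : G.StronglyConnected)
    (ha : G.IsUpperAux s r a) : ¬ G.Dominates s r a := fun h =>
  ha.2.1.2 (ha.2.1.1.antisymm hs hG h)

theorem exists_shrinksTo (hV : G.verts.Finite) (hs : s ∈ G.verts) (hG : G.StronglyConnected)
    (hr : r ∈ G.verts) (hv : v ∈ G.verts) : ∃ a, G.ShrinksTo s r v a := by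
  by_cases h : G.Dominates s r v
  · rcases mem_tree_or_dominates hV hs hG h with h | ⟨z, hz, h⟩
    · exact ⟨v, Or.inl ⟨h, rfl⟩⟩
    · exact ⟨z, Or.inr (Or.inl ⟨hz, h⟩)⟩
  · have hrs : r ≠ s := by
      rintro rfl
      exact h (dominates_root hs hv)
    obtain ⟨d, hd⟩ := exists_isImmDom hV hs hG hr hrs
    exact ⟨d, Or.inr (Or.inr ⟨hrs, ⟨dominates_root hs hv, h⟩, hd⟩)⟩

theorem ShrinksTo.unique (hs : s ∈ G.verts) (hG : G.StronglyConnected) (hr : r ∈ G.verts)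
    (ha : G.ShrinksTo s r v a) (hb : G.ShrinksTo s r v b) : a = b := by
  rcases ha with ⟨h1, rfl⟩ | ⟨h1, h2⟩ | ⟨h1, ⟨-, h2⟩, h3⟩ <;>
    rcases hb with ⟨k1, rfl⟩ | ⟨k1, k2⟩ | ⟨k1, ⟨-, k2⟩, k3⟩
  · rfl
  · exact absurd k2 (k1.not_dominates hs hG hr h1)
  · exact absurd (dominates_of_mem_tree hs hr h1) k2
  · exact absurd h2 (h1.not_dominates hs hG hr k1)
  · rcases Dominates.total hs hG h2 k2 with h | h
    · exact h1.eq_of_dominates hs hG hr k1 h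
    · exact (k1.eq_of_dominates hs hG hr h1 h).symm
  · exact absurd ((h1.dominates hs hr).trans hs h2) k2
  · exact absurd (dominates_of_mem_tree hs hr k1) h2
  · exact absurd ((k1.dominates hs hr).trans hs k2) h2
  · exact h3.unique hs hG k3

theorem shrinksTo_self_of_mem_tree (h : v ∈ G.tree s r) : G.ShrinksTo s r v v := Or.inl ⟨h, rfl⟩

theorem IsLowerAux.shrinksTo_iff (hs : s ∈ G.verts) (hG : G.StronglyConnected) (hr : r ∈ G.verts)
    (hz : G.IsLowerAux s r z) : G.ShrinksTo s r v z ↔ G.Dominates s z v := by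
  refine ⟨fun h => ?_, fun h => Or.inr (Or.inl ⟨hz, h⟩)⟩
  rcases h with ⟨h, rfl⟩ | ⟨-, h⟩ | ⟨h1, -, h3⟩
  · exact absurd (dominates_refl (dominates_of_mem_tree hs hr h).2.1)
      (hz.not_dominates hs hG hr h)
  · exact h
  · exact absurd (hz.dominates hs hr) (IsUpperAux.not_dominates hs hG ⟨h1, h3⟩)

theorem IsUpperAux.shrinksTo_iff (hs : s ∈ G.verts) (hG : G.StronglyConnected) (hr : r ∈ G.verts)
    (ha : G.IsUpperAux s r a) : G.ShrinksTo s r v a ↔ v ∈ G.verts ∧ ¬ G.Dominates s r v := by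
  refine ⟨fun h => ?_, fun h => Or.inr (Or.inr ⟨ha.1, ⟨dominates_root hs h.1, h.2⟩, ha.2⟩)⟩
  rcases h with ⟨h, rfl⟩ | ⟨h1, h2⟩ | ⟨-, h, -⟩
  · exact absurd (dominates_of_mem_tree hs hr h) (ha.not_dominates hs hG)
  · exact absurd (h1.dominates hs hr) (ha.not_dominates hs hG)
  · exact ⟨h.1.2.1, h.2⟩

theorem ShrinksTo.eq_of_mem_tree (hs : s ∈ G.verts) (hG : G.StronglyConnected) (hr : r ∈ G.verts)
    (h : G.ShrinksTo s r v a) (ha : a ∈ G.tree s r) : v = a := by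
  rcases h with ⟨-, h⟩ | ⟨h1, -⟩ | ⟨h1, -, h3⟩
  · exact h.symm
  · exact absurd (dominates_refl (dominates_of_mem_tree hs hr ha).2.1)
      (h1.not_dominates hs hG hr ha)
  · exact absurd (dominates_of_mem_tree hs hr ha) (IsUpperAux.not_dominates hs hG ⟨h1, h3⟩)

theorem ShrinksTo.cases (h : G.ShrinksTo s r v a) :
    a ∈ G.tree s r ∨ G.IsLowerAux s r a ∨ G.IsUpperAux s r a := by
  rcases h with ⟨h, rfl⟩ | ⟨h, -⟩ | ⟨h1, -, h3⟩
  · exact Or.inl h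
  · exact Or.inr (Or.inl h)
  · exact Or.inr (Or.inr ⟨h1, h3⟩)

/-- The bridge is the only edge that enters a lower auxiliary vertex. -/
theorem IsBridge.eq_of_shrinksTo_lower (hs : s ∈ G.verts) (hG : G.StronglyConnected)
    (hr : r ∈ G.verts) (he : G.IsBridge s e) (hz : G.IsLowerAux s r (G.tgt e)) (hf : f ∈ G.edges)
    (h1 : ¬ G.ShrinksTo s r (G.src f) (G.tgt e)) (h2 : G.ShrinksTo s r (G.tgt f) (G.tgt e)) :
    f = e :=
  he.eq_of_enters hs hf (fun h => h1 ((hz.shrinksTo_iff hs hG hr).mpr h))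
    ((hz.shrinksTo_iff hs hG hr).mp h2)

/-- The bridge is the only edge that leaves the upper auxiliary vertex. -/
theorem IsBridge.eq_of_shrinksTo_upper (hs : s ∈ G.verts) (hG : G.StronglyConnected)
    (hr : G.tgt e ∈ G.verts) (he : G.IsBridge s e) (ha : G.IsUpperAux s (G.tgt e) a)
    (hf : f ∈ G.edges) (h1 : G.ShrinksTo s (G.tgt e) (G.src f) a)
    (h2 : ¬ G.ShrinksTo s (G.tgt e) (G.tgt f) a) : f = e := by
  rw [ha.shrinksTo_iff hs hG hr] at h1 h2
  refine he.eq_of_enters hs hf h1.2 ?_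
  by_contra h
  exact h2 ⟨G.tgt_mem f hf, h⟩

end Shrinking

end MultiDigraph
namespace MultiDigraph

/-! ### Edges of the auxiliary graph and their preimages. -/

section AuxGraph

variable {α β : Type*} {G : MultiDigraph α β} {S : Set β} {s d r u v w a b z x y : α} {e f g : β}

theorem auxGraph_verts_subset (hs : s ∈ G.verts) (hr : r ∈ G.verts) :
    (G.auxGraph s r).verts ⊆ G.verts := by
  rintro v ((h | h) | h)
  · exact (dominates_of_mem_tree hs hr h).2.1
  · exact (h.dominates hs hr).2.1
  · exact h.2.1.1.1

theorem auxGraph_edges_finite (hV : G.verts.Finite) (hs : s ∈ G.verts) (hr : r ∈ G.verts) :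
    (G.auxGraph s r).edges.Finite :=
  (hV.prod (hV.prod (Set.finite_univ (α := Fin 2)))).subset fun t ht =>
    ⟨auxGraph_verts_subset hs hr ((G.auxGraph s r).src_mem t ht),
      auxGraph_verts_subset hs hr ((G.auxGraph s r).tgt_mem t ht), trivial⟩

theorem mem_auxGraph_edges (hf : f ∈ G.edges) (h1 : G.ShrinksTo s r (G.src f) a)
    (h2 : G.ShrinksTo s r (G.tgt f) b) (hab : a ≠ b) : (a, b, 0) ∈ (G.auxGraph s r).edges :=
  ⟨hab, Nat.cast_zero (R := ℕ∞) ▸ Set.encard_pos.mpr ⟨f, hf, h1, h2⟩⟩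

theorem mem_auxGraph_edges_of_ne (hf : f ∈ G.edges) (h1 : G.ShrinksTo s r (G.src f) a)
    (h2 : G.ShrinksTo s r (G.tgt f) b) (hg : g ∈ G.edges) (k1 : G.ShrinksTo s r (G.src g) a)
    (k2 : G.ShrinksTo s r (G.tgt g) b) (hfg : f ≠ g) (hab : a ≠ b) (i : Fin 2) :
    (a, b, i) ∈ (G.auxGraph s r).edges := by
  refine ⟨hab, lt_of_le_of_lt ?_
    (Set.one_lt_encard_iff.mpr ⟨f, g, ⟨hf, h1, h2⟩, ⟨hg, k1, k2⟩, hfg⟩)⟩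
  exact_mod_cast Nat.le_of_lt_succ i.2

theorem exists_lift {t : α × α × Fin 2} (ht : t ∈ (G.auxGraph s r).edges) :
    ∃ f ∈ G.edges, G.ShrinksTo s r (G.src f) t.1 ∧ G.ShrinksTo s r (G.tgt f) t.2.1 :=
  Set.encard_pos.mp (pos_of_gt ht.2)

theorem exists_lift_ne {t : α × α × Fin 2} (ht : t ∈ (G.auxGraph s r).edges) (ht0 : t.2.2 ≠ 0)
    (e : β) : ∃ f ∈ G.edges, f ≠ e ∧
      G.ShrinksTo s r (G.src f) t.1 ∧ G.ShrinksTo s r (G.tgt f) t.2.1 := by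
  have h1 : ((t.2.2 : ℕ) : ℕ∞) = 1 := by
    have : (t.2.2 : ℕ) = 1 := by omega
    rw [this, Nat.cast_one]
  obtain ⟨f, g, hf, hg, hfg⟩ := Set.one_lt_encard_iff.mp (h1 ▸ ht.2)
  by_cases hfe : f = e
  · exact ⟨g, hg.1, fun h => hfg (hfe.trans h.symm), hg.2⟩
  · exact ⟨f, hf.1, hfe, hf.2⟩

theorem enters_lower (hs : s ∈ G.verts) (hG : G.StronglyConnected) (hr : r ∈ G.verts)
    (hf : f ∈ G.edges) (h1 : G.ShrinksTo s r (G.src f) a) (h2 : G.ShrinksTo s r (G.tgt f) b)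
    (hab : a ≠ b) (hb : G.IsLowerAux s r b) :
    G.IsBridge s f ∧ G.tgt f = b ∧ G.src f = a ∧ a ∈ G.tree s r ∧ G.IsImmDom s a b := by
  obtain ⟨e, he, rfl, het⟩ := hb.exists_bridge hs hG
  obtain rfl : f = e := he.eq_of_shrinksTo_lower hs hG hr hb hf
    (fun h => hab (h1.unique hs hG hr h)) h2
  obtain rfl := h1.unique hs hG hr (shrinksTo_self_of_mem_tree het)
  exact ⟨he, rfl, rfl, het, he.isImmDom hs hG⟩

theorem leaves_upper (hs : s ∈ G.verts) (hG : G.StronglyConnected) (hr : r ∈ G.verts)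
    (hrs : r = s ∨ G.Marked s r) (hf : f ∈ G.edges) (h1 : G.ShrinksTo s r (G.src f) a)
    (h2 : G.ShrinksTo s r (G.tgt f) b) (hab : a ≠ b) (ha : G.IsUpperAux s r a) :
    G.IsBridge s f ∧ G.tgt f = r ∧ G.src f = a ∧ b = r := by
  obtain ⟨e, he, rfl⟩ := hrs.resolve_left ha.1
  obtain rfl : f = e := he.eq_of_shrinksTo_upper hs hG hr ha hf h1
    (fun h => hab (h.unique hs hG hr h2))
  exact ⟨he, rfl, (he.isImmDom hs hG).unique hs hG ha.2,
    h2.unique hs hG hr (shrinksTo_self_of_mem_tree Relation.ReflTransGen.refl)⟩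

theorem IsLowerAux.not_mem_tree (hs : s ∈ G.verts) (hG : G.StronglyConnected) (hr : r ∈ G.verts)
    (hz : G.IsLowerAux s r z) : z ∉ G.tree s r := fun h =>
  hz.not_dominates hs hG hr h (dominates_refl (hz.dominates hs hr).2.1)

theorem IsUpperAux.not_mem_tree (hs : s ∈ G.verts) (hG : G.StronglyConnected) (hr : r ∈ G.verts)
    (ha : G.IsUpperAux s r a) : a ∉ G.tree s r := fun h =>
  ha.not_dominates hs hG (dominates_of_mem_tree hs hr h)

theorem IsLowerAux.not_isUpperAux (hs : s ∈ G.verts) (hG : G.StronglyConnected)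
    (hr : r ∈ G.verts) (hz : G.IsLowerAux s r z) : ¬ G.IsUpperAux s r z := fun h =>
  h.not_dominates hs hG (hz.dominates hs hr)

/-! ### From the graph to the auxiliary graph. -/

/-- The edges of `H(G_s, r)` other than `t` that come from `S` and do not go back along a bridge
between an ordinary and an auxiliary vertex. -/
def shrunkEdges (G : MultiDigraph α β) (s r : α) (S : Set β) (t : α × α × Fin 2) :
    Set (α × α × Fin 2) :=
  {q ∈ (G.auxGraph s r).edges \ {t} |
    (∃ f ∈ S, G.ShrinksTo s r (G.src f) q.1 ∧ G.ShrinksTo s r (G.tgt f) q.2.1) ∧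
    ¬ (G.IsLowerAux s r q.1 ∧ G.IsImmDom s q.2.1 q.1) ∧
    ¬ (q.1 = r ∧ G.IsUpperAux s r q.2.1)}

/-- Twins between ordinary vertices come from twins in `S`. At an auxiliary vertex one of the two
twins would come from its bridge, and the other is a removed reverse edge. -/
theorem TwinFree.shrunkEdges (hs : s ∈ G.verts) (hG : G.StronglyConnected) (hr : r ∈ G.verts)
    (hrs : r = s ∨ G.Marked s r) (hS : S ⊆ G.edges) (hT : G.TwinFree S) (t : α × α × Fin 2) :
    (G.auxGraph s r).TwinFree (G.shrunkEdges s r S t) := by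
  rintro ⟨a, b, i⟩ ⟨⟨⟨hab, -⟩, -⟩, ⟨f, hf, f1, f2⟩, n1, n2⟩
    ⟨b', a', j⟩ ⟨-, ⟨g, hg, g1, g2⟩, m1, m2⟩ - ⟨h1, h2⟩
  obtain rfl : a = a' := h1
  obtain rfl : b = b' := h2
  dsimp only at *
  rcases f1.cases with ha | ha | ha
  · rcases f2.cases with hb | hb | hb
    · have := f1.eq_of_mem_tree hs hG hr ha
      have := f2.eq_of_mem_tree hs hG hr hb
      have := g1.eq_of_mem_tree hs hG hr hb
      have := g2.eq_of_mem_tree hs hG hr ha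
      refine hT f hf g hg ?_ ⟨by simp_all, by simp_all⟩
      rintro rfl
      exact hab (f1.unique hs hG hr g1)
    · exact m1 ⟨hb, (enters_lower hs hG hr (hS hf) f1 f2 hab hb).2.2.2.2⟩
    · exact n2 ⟨(leaves_upper hs hG hr hrs (hS hg) g1 g2 hab.symm hb).2.2.2, hb⟩
  · exact n1 ⟨ha, (enters_lower hs hG hr (hS hg) g1 g2 hab.symm ha).2.2.2.2⟩
  · exact m2 ⟨(leaves_upper hs hG hr hrs (hS hf) f1 f2 hab ha).2.2.2, ha⟩

theorem Reach.shrunkEdges (hV : G.verts.Finite) (hs : s ∈ G.verts) (hG : G.StronglyConnected)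
    (hr : r ∈ G.verts) (hrs : r = s ∨ G.Marked s r) {t : α × α × Fin 2} (he : e ∈ G.edges)
    (he1 : G.ShrinksTo s r (G.src e) t.1) (he2 : G.ShrinksTo s r (G.tgt e) t.2.1)
    (hS : S ⊆ G.edges \ {e}) (hx : x ∈ G.tree s r) (hy : y ∈ G.tree s r)
    (h : G.Reach S x y) : (G.auxGraph s r).Reach (G.shrunkEdges s r S t) x y := by
  set T := G.shrunkEdges s r S t
  have hcross : ∀ f ∈ S, ∀ a b, G.ShrinksTo s r (G.src f) a → G.ShrinksTo s r (G.tgt f) b →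
      a ≠ b → ∃ i, (a, b, i) ∈ (G.auxGraph s r).edges \ {t} := by
    intro f hf a b h1 h2 hab
    by_cases ht : t.1 = a ∧ t.2.1 = b
    · obtain ⟨rfl, rfl⟩ := ht
      -- Now `e` and `f` are distinct preimages, so both copies exist; adding `1` in `Fin 2` selects
      -- the copy other than `t`.
      refine ⟨t.2.2 + 1, mem_auxGraph_edges_of_ne he he1 he2 (hS hf).1 h1 h2
        (fun hef => (hS hf).2 hef.symm) hab _, fun h => ?_⟩
      have h3 : t.2.2 + 1 = t.2.2 := congrArg (fun q => q.2.2) h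
      revert h3
      generalize t.2.2 = i
      revert i
      decide
    · refine ⟨0, mem_auxGraph_edges (hS hf).1 h1 h2 hab, fun h => ht ?_⟩
      rw [← Set.mem_singleton_iff.mp h]
      exact ⟨rfl, rfl⟩
  -- The invariant compensates for the removed edges: at the upper vertex it is enough to have
  -- reached `r`, where the walk must return, and at a lower vertex its immediate dominator has been
  -- reached as well.
  have key : ∀ a, G.ShrinksTo s r y a →
      ((G.auxGraph s r).Reach T x a ∨ (G.IsUpperAux s r a ∧ (G.auxGraph s r).Reach T x r)) ∧
      (G.IsLowerAux s r a → ∀ d, G.IsImmDom s d a → (G.auxGraph s r).Reach T x d) := by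
    refine h.induct (P := fun w => ∀ a, G.ShrinksTo s r w a →
      ((G.auxGraph s r).Reach T x a ∨ (G.IsUpperAux s r a ∧ (G.auxGraph s r).Reach T x r)) ∧
      (G.IsLowerAux s r a → ∀ d, G.IsImmDom s d a → (G.auxGraph s r).Reach T x d)) ?_ ?_
    · intro a ha
      obtain rfl := (shrinksTo_self_of_mem_tree hx).unique hs hG hr ha
      exact ⟨Or.inl (Reach.refl _ _ _), fun h => absurd hx (h.not_mem_tree hs hG hr)⟩
    · intro f hf ih b hb
      have hfE := (hS hf).1
      obtain ⟨a, ha⟩ := exists_shrinksTo hV hs hG hr (G.src_mem f hfE)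
      obtain ⟨hor, hlow⟩ := ih a ha
      by_cases hab : a = b
      · subst hab
        exact ⟨hor, hlow⟩
      obtain ⟨i, hi⟩ := hcross f hf a b ha hb hab
      refine ⟨?_, fun hbl d hd => ?_⟩
      · rcases hor with hxa | ⟨hup, hxr⟩
        · by_cases c1 : G.IsLowerAux s r a ∧ G.IsImmDom s b a
          · exact Or.inl (hlow c1.1 b c1.2)
          by_cases c2 : a = r ∧ G.IsUpperAux s r b
          · exact Or.inr ⟨c2.2, c2.1 ▸ hxa⟩
          exact Or.inl (Reach.step (G := G.auxGraph s r) (f := (a, b, i)) hxa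
            ⟨hi, ⟨f, hf, ha, hb⟩, c1, c2⟩)
        · rw [(leaves_upper hs hG hr hrs hfE ha hb hab hup).2.2.2]
          exact Or.inl hxr
      · obtain ⟨-, -, -, hat, hdom⟩ := enters_lower hs hG hr hfE ha hb hab hbl
        obtain rfl := hdom.unique hs hG hd
        exact hor.resolve_right fun h => h.1.not_mem_tree hs hG hr hat
  exact (key y (shrinksTo_self_of_mem_tree hy)).1.resolve_right
    fun h => h.1.not_mem_tree hs hG hr hy

theorem twinlessLinked_auxGraph (hV : G.verts.Finite) (hs : s ∈ G.verts)
    (hG : G.StronglyConnected) (hr : r ∈ G.verts) (hrs : r = s ∨ G.Marked s r)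
    (hx : x ∈ G.tree s r) (hy : y ∈ G.tree s r)
    (h : ∀ e ∈ G.edges, G.TwinlessLinked (G.edges \ {e}) x y)
    {t : α × α × Fin 2} (ht : t ∈ (G.auxGraph s r).edges) :
    (G.auxGraph s r).TwinlessLinked ((G.auxGraph s r).edges \ {t}) x y := by
  obtain ⟨e, he, he1, he2⟩ := exists_lift ht
  obtain ⟨S, hS, hT, hxy, hyx⟩ := h e he
  exact ⟨G.shrunkEdges s r S t, fun q hq => hq.1,
    hT.shrunkEdges hs hG hr hrs (hS.trans Set.sdiff_subset) t,
    hxy.shrunkEdges hV hs hG hr hrs he he1 he2 hS hx hy,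
    hyx.shrunkEdges hV hs hG hr hrs he he1 he2 hS hy hx⟩

/-- After deletion of the bridge into a marked `z`, nothing enters `D(z)`. Mutual reachability then
puts both or neither of `x` and `y` in each such set. -/
theorem exists_common_tree (hV : G.verts.Finite) (hs : s ∈ G.verts) (hG : G.StronglyConnected)
    (hx : x ∈ G.verts) (hy : y ∈ G.verts)
    (h : ∀ e ∈ G.edges, G.TwinlessLinked (G.edges \ {e}) x y) :
    ∃ r ∈ G.verts, (r = s ∨ G.Marked s r) ∧ x ∈ G.tree s r ∧ y ∈ G.tree s r := by
  have hiff : ∀ z, G.Marked s z → (G.Dominates s z x ↔ G.Dominates s z y) := by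
    rintro _ ⟨e, he, rfl⟩
    obtain ⟨S, hS, -, hxy, hyx⟩ := h e he.1
    exact ⟨fun hd => by_contra fun hc => he.not_dominates_of_reach hs hS hyx hc hd,
      fun hd => by_contra fun hc => he.not_dominates_of_reach hs hS hxy hc hd⟩
  obtain ⟨r, hr, hrs, hxr⟩ := exists_mem_tree hV hs hG hx
  refine ⟨r, hr, hrs, hxr, ?_⟩
  have hry : G.Dominates s r y := by
    rcases hrs with rfl | hm
    · exact dominates_root hs hy
    · exact (hiff r hm).mp (dominates_of_mem_tree hs hr hxr)
  refine (mem_tree_or_dominates hV hs hG hry).resolve_right ?_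
  rintro ⟨z, hz, hzy⟩
  exact hz.not_dominates hs hG hr hxr ((hiff z hz.1).mpr hzy)

/-! ### From the auxiliary graph to the graph. -/

/-- A search out of the root serves a lower vertex. For the upper vertex the search runs in the
reversed graph and leads into the tail of the bridge. -/
theorem exists_inner_edges (hs : s ∈ G.verts) (hG : G.StronglyConnected) (hr : r ∈ G.verts)
    (hrs : r = s ∨ G.Marked s r) (c : α) :
    ∃ B ⊆ {f ∈ G.edges | G.ShrinksTo s r (G.src f) c ∧ G.ShrinksTo s r (G.tgt f) c},
      G.TwinFree B ∧
      (G.IsLowerAux s r c → ∀ w, G.ShrinksTo s r w c → G.Reach B c w) ∧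
      (G.IsUpperAux s r c → ∀ w, G.ShrinksTo s r w c → G.Reach B w c) := by
  by_cases hl : G.IsLowerAux s r c
  · obtain ⟨B, hB, hT, hR⟩ := G.exists_twinFree_reach
      {f ∈ G.edges | G.Dominates s c (G.src f) ∧ G.Dominates s c (G.tgt f)} c
    simp only [hl.shrinksTo_iff hs hG hr]
    exact ⟨B, hB, hT, fun _ w hw => hR w (reach_in_domSubtree hs hG hw),
      fun h => absurd h (hl.not_isUpperAux hs hG hr)⟩
  · by_cases hu : G.IsUpperAux s r c
    · obtain ⟨e, he, rfl⟩ := hrs.resolve_left hu.1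
      obtain rfl := (he.isImmDom hs hG).unique hs hG hu.2
      obtain ⟨B, hB, hT, hR⟩ := G.rev.exists_twinFree_reach
        {f ∈ G.edges | ¬ G.Dominates s (G.tgt e) (G.src f) ∧
          ¬ G.Dominates s (G.tgt e) (G.tgt f)} (G.src e)
      simp only [hu.shrinksTo_iff hs hG hr]
      refine ⟨B, fun f hf => ?_, hT.rev, fun h => absurd h hl, fun _ w hw => ?_⟩
      · have h := hB hf
        exact ⟨h.1, ⟨G.src_mem f h.1, h.2.1⟩, ⟨G.tgt_mem f h.1, h.2.2⟩⟩
      · exact (hR w (he.reach_src hs hG hw.1 hw.2).rev).rev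
    · exact ⟨∅, Set.empty_subset _, fun e he => absurd he (Set.notMem_empty e),
        fun h => absurd h hl, fun h => absurd h hu⟩

/-- A twin-free connection in `H(G_s, r)` lifts to `G` if its edges have preimages other than `e`
and if it does not pass through the auxiliary vertex into which `e` is shrunk. -/
theorem TwinFree.twinlessLinked_lift (hs : s ∈ G.verts) (hG : G.StronglyConnected)
    (hr : r ∈ G.verts) (hrs : r = s ∨ G.Marked s r) {T : Set (α × α × Fin 2)}
    (hx : x ∈ G.tree s r) (hy : y ∈ G.tree s r) (hTH : T ⊆ (G.auxGraph s r).edges)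
    (hT : (G.auxGraph s r).TwinFree T)
    (hlift : ∀ t ∈ T, ∃ f ∈ G.edges, f ≠ e ∧
      G.ShrinksTo s r (G.src f) t.1 ∧ G.ShrinksTo s r (G.tgt f) t.2.1)
    (hlow : ∀ t ∈ T, G.IsLowerAux s r t.2.1 →
      ¬ (G.ShrinksTo s r (G.src e) t.2.1 ∧ G.ShrinksTo s r (G.tgt e) t.2.1))
    (hup : ∀ t ∈ T, G.IsUpperAux s r t.1 →
      ¬ (G.ShrinksTo s r (G.src e) t.1 ∧ G.ShrinksTo s r (G.tgt e) t.1))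
    (hxy : (G.auxGraph s r).Reach T x y) (hyx : (G.auxGraph s r).Reach T y x) :
    G.TwinlessLinked (G.edges \ {e}) x y := by
  choose B hBsub hBT hBl hBu using exists_inner_edges hs hG hr hrs
  set S : Set β := {f ∈ G.edges \ {e} |
    (∃ t ∈ T, G.ShrinksTo s r (G.src f) t.1 ∧ G.ShrinksTo s r (G.tgt f) t.2.1) ∨
    ∃ c, f ∈ B c}
  have hBS : ∀ c, ¬ (G.ShrinksTo s r (G.src e) c ∧ G.ShrinksTo s r (G.tgt e) c) → B c ⊆ S := by
    intro c hc f hf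
    refine ⟨⟨(hBsub c hf).1, ?_⟩, Or.inr ⟨c, hf⟩⟩
    rintro rfl
    exact hc (hBsub c hf).2
  have hmain : ∀ x ∈ G.tree s r, ∀ y ∈ G.tree s r, (G.auxGraph s r).Reach T x y →
      G.Reach S x y := by
    intro x hx y hy h
    -- A lower vertex is reached at its root, by the bridge. The upper one may be entered anywhere,
    -- so its representative is claimed only when `e` is not inside; if `e` is inside, `hup`
    -- prevents `T` from leaving it.
    refine (h.induct (P := fun a => (a ∈ G.tree s r → G.Reach S x a) ∧
      (G.IsLowerAux s r a → G.Reach S x a ∧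
        ¬ (G.ShrinksTo s r (G.src e) a ∧ G.ShrinksTo s r (G.tgt e) a)) ∧
      (G.IsUpperAux s r a →
        ¬ (G.ShrinksTo s r (G.src e) a ∧ G.ShrinksTo s r (G.tgt e) a) → G.Reach S x a))
      ⟨fun _ => Reach.refl _ _ _, fun h => absurd hx (h.not_mem_tree hs hG hr),
        fun h => absurd hx (h.not_mem_tree hs hG hr)⟩ ?_).1 hy
    rintro ⟨a, b, i⟩ ht ⟨ih1, ih2, ih3⟩
    change a ∈ G.tree s r → G.Reach S x a at ih1
    change G.IsLowerAux s r a → _ at ih2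
    change G.IsUpperAux s r a → _ at ih3
    change (b ∈ G.tree s r → G.Reach S x b) ∧ (G.IsLowerAux s r b → G.Reach S x b ∧
        ¬ (G.ShrinksTo s r (G.src e) b ∧ G.ShrinksTo s r (G.tgt e) b)) ∧
      (G.IsUpperAux s r b →
        ¬ (G.ShrinksTo s r (G.src e) b ∧ G.ShrinksTo s r (G.tgt e) b) → G.Reach S x b)
    have hab : a ≠ b := (hTH ht).1
    obtain ⟨f, hf, hfe, f1, f2⟩ := hlift _ ht
    have hfS : f ∈ S := ⟨⟨hf, hfe⟩, Or.inl ⟨_, ht, f1, f2⟩⟩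
    have hsrc : G.Reach S x (G.src f) := by
      rcases f1.cases with ha | ha | ha
      · rw [f1.eq_of_mem_tree hs hG hr ha]
        exact ih1 ha
      · exact (ih2 ha).1.trans ((hBl a ha _ f1).mono (hBS a (ih2 ha).2))
      · rw [(leaves_upper hs hG hr hrs hf f1 f2 hab ha).2.2.1]
        exact ih3 ha (hup _ ht ha)
    have htgt := hsrc.step hfS
    dsimp only at f2
    refine ⟨fun hb => ?_, fun hb => ⟨?_, hlow _ ht hb⟩, fun hb hbe => ?_⟩
    · exact f2.eq_of_mem_tree hs hG hr hb ▸ htgt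
    · exact (enters_lower hs hG hr hf f1 f2 hab hb).2.1 ▸ htgt
    · exact htgt.trans ((hBu b hb _ f2).mono (hBS b hbe))
  refine ⟨S, fun f hf => hf.1, ?_, hmain x hx y hy hxy, hmain y hy x hx hyx⟩
  -- Twins of `G` have the same pair of images: distinct images give twins in `T`, equal images
  -- place both edges in the same `B c`.
  rintro f ⟨-, ⟨t, ht, t1, t2⟩ | ⟨c, hc⟩⟩ g ⟨-, ⟨q, hq, q1, q2⟩ | ⟨c', hc'⟩⟩ hfg ⟨h1, h2⟩
  · rw [← h1] at q2
    rw [← h2] at q1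
    have e1 := t1.unique hs hG hr q2
    have e2 := t2.unique hs hG hr q1
    refine hT t ht q hq ?_ ⟨e1, e2⟩
    rintro rfl
    exact (hTH ht).1 e2.symm
  · obtain ⟨-, c1, c2⟩ := hBsub c' hc'
    rw [← h1] at c2
    rw [← h2] at c1
    exact (hTH ht).1 ((t1.unique hs hG hr c2).trans (c1.unique hs hG hr t2))
  · obtain ⟨-, c1, c2⟩ := hBsub c hc
    rw [h1] at c1
    rw [h2] at c2
    exact (hTH hq).1 ((q1.unique hs hG hr c2).trans (c1.unique hs hG hr q2))
  · have c1 := (hBsub c hc).2.1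
    rw [h1] at c1
    obtain rfl := c1.unique hs hG hr (hBsub c' hc').2.2
    exact hBT c f hc g hc' hfg ⟨h1, h2⟩

/-- With no edge to delete, the hypothesis on `H(G_s, r)` would be vacuous. -/
theorem auxGraph_edges_nonempty (hV : G.verts.Finite) (hs : s ∈ G.verts)
    (hG : G.StronglyConnected) (hr : r ∈ G.verts) (hx : x ∈ G.tree s r) (hy : y ∈ G.tree s r)
    (hxy : x ≠ y) : (G.auxGraph s r).edges.Nonempty := by
  by_contra hc
  refine hxy (ShrinksTo.unique (v := y) hs hG hr ?_ (shrinksTo_self_of_mem_tree hy))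
  refine (hG.reach (dominates_of_mem_tree hs hr hx).2.1
    (dominates_of_mem_tree hs hr hy).2.1).induct (P := fun w => G.ShrinksTo s r w x)
    (shrinksTo_self_of_mem_tree hx) fun f hf h => ?_
  obtain ⟨b, hb⟩ := exists_shrinksTo hV hs hG hr (G.tgt_mem f hf)
  by_cases hxb : x = b
  · exact hxb ▸ hb
  · exact absurd ⟨_, mem_auxGraph_edges hf h hb hxb⟩ hc

theorem twinlessLinked_of_auxGraph (hV : G.verts.Finite) (hs : s ∈ G.verts)
    (hG : G.StronglyConnected) (hr : r ∈ G.verts) (hrs : r = s ∨ G.Marked s r)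
    (hx : x ∈ G.tree s r) (hy : y ∈ G.tree s r)
    (h : ∀ t ∈ (G.auxGraph s r).edges,
      (G.auxGraph s r).TwinlessLinked ((G.auxGraph s r).edges \ {t}) x y)
    (he : e ∈ G.edges) : G.TwinlessLinked (G.edges \ {e}) x y := by
  by_cases hne : x = y
  · subst hne
    exact ⟨∅, Set.empty_subset _, fun e he => absurd he (Set.notMem_empty e),
      Reach.refl _ _ _, Reach.refl _ _ _⟩
  obtain ⟨a, ha⟩ := exists_shrinksTo hV hs hG hr (G.src_mem e he)
  obtain ⟨b, hb⟩ := exists_shrinksTo hV hs hG hr (G.tgt_mem e he)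
  by_cases hab : a = b
  · subst hab
    have hlift : ∀ t ∈ (G.auxGraph s r).edges, ∃ f ∈ G.edges, f ≠ e ∧
        G.ShrinksTo s r (G.src f) t.1 ∧ G.ShrinksTo s r (G.tgt f) t.2.1 := by
      intro t ht
      obtain ⟨f, hf, f1, f2⟩ := exists_lift ht
      refine ⟨f, hf, ?_, f1, f2⟩
      rintro rfl
      exact ht.1 ((f1.unique hs hG hr ha).trans (hb.unique hs hG hr f2))
    -- Here `e` disappears in the shrinking. The edge `t₀` is the image of the bridge at the
    -- auxiliary vertex containing `e`: without it a lower vertex is never entered and the upper one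
    -- never left. If `e` is a loop at an ordinary vertex, any `t₀` will do.
    obtain ⟨t₀, ht₀, hlow, hup⟩ : ∃ t₀ ∈ (G.auxGraph s r).edges,
        (∀ t ∈ (G.auxGraph s r).edges \ {t₀}, ¬ (G.IsLowerAux s r a ∧ t.2.1 = a)) ∧
        (∀ t ∈ (G.auxGraph s r).edges \ {t₀}, ¬ (G.IsUpperAux s r a ∧ t.1 = a)) := by
      rcases ha.cases with hc | hc | hc
      · obtain ⟨t₀, ht₀⟩ := auxGraph_edges_nonempty hV hs hG hr hx hy hne
        exact ⟨t₀, ht₀, fun _ _ h => h.1.not_mem_tree hs hG hr hc,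
          fun _ _ h => h.1.not_mem_tree hs hG hr hc⟩
      · obtain ⟨g, hg, rfl, hgt⟩ := hc.exists_bridge hs hG
        have g1 := shrinksTo_self_of_mem_tree hgt
        refine ⟨_, mem_auxGraph_edges hg.1 g1 ((hc.shrinksTo_iff hs hG hr).mpr
          (dominates_refl (G.tgt_mem g hg.1))) (hg.isImmDom hs hG).1.2, ?_,
          fun _ _ h => hc.not_isUpperAux hs hG hr h.1⟩
        rintro ⟨c, d, i⟩ ⟨ht, htne⟩ ⟨-, hd⟩
        obtain rfl : d = G.tgt g := hd
        have huniq : ∀ f ∈ G.edges, G.ShrinksTo s r (G.src f) c →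
            G.ShrinksTo s r (G.tgt f) (G.tgt g) → f = g := fun f hf f1 f2 =>
          hg.eq_of_shrinksTo_lower hs hG hr hc hf
            (fun h => ht.1 (f1.unique hs hG hr h)) f2
        obtain ⟨f, hf, f1, f2⟩ := exists_lift ht
        obtain rfl := huniq f hf f1 f2
        obtain rfl := g1.unique hs hG hr f1
        by_cases hi : i = 0
        · subst hi
          exact htne rfl
        · obtain ⟨f', hf', hne', k1, k2⟩ := exists_lift_ne ht hi f
          exact hne' (huniq f' hf' k1 k2)
      · obtain ⟨g, hg, rfl⟩ := hrs.resolve_left hc.1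
        obtain rfl := (hg.isImmDom hs hG).unique hs hG hc.2
        have g1 : G.ShrinksTo s (G.tgt g) (G.src g) (G.src g) :=
          (hc.shrinksTo_iff hs hG hr).mpr ⟨G.src_mem g hg.1, hc.not_dominates hs hG⟩
        have g2 : G.ShrinksTo s (G.tgt g) (G.tgt g) (G.tgt g) :=
          shrinksTo_self_of_mem_tree Relation.ReflTransGen.refl
        refine ⟨_, mem_auxGraph_edges hg.1 g1 g2 (hg.isImmDom hs hG).1.2,
          fun _ _ h => h.1.not_isUpperAux hs hG hr hc, ?_⟩
        rintro ⟨c, d, i⟩ ⟨ht, htne⟩ ⟨-, hd⟩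
        obtain rfl : c = G.src g := hd
        have huniq : ∀ f ∈ G.edges, G.ShrinksTo s (G.tgt g) (G.src f) (G.src g) →
            G.ShrinksTo s (G.tgt g) (G.tgt f) d → f = g := fun f hf f1 f2 =>
          hg.eq_of_shrinksTo_upper hs hG hr hc hf f1
            (fun h => ht.1 (h.unique hs hG hr f2))
        obtain ⟨f, hf, f1, f2⟩ := exists_lift ht
        obtain rfl := huniq f hf f1 f2
        obtain rfl := g2.unique hs hG hr f2
        by_cases hi : i = 0
        · subst hi
          exact htne rfl
        · obtain ⟨f', hf', hne', k1, k2⟩ := exists_lift_ne ht hi f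
          exact hne' (huniq f' hf' k1 k2)
    obtain ⟨T, hTsub, hT, hxy, hyx⟩ := h t₀ ht₀
    have hTH := hTsub.trans Set.sdiff_subset
    refine hT.twinlessLinked_lift hs hG hr hrs hx hy hTH (fun t ht => hlift t (hTH ht))
      (fun t ht hl hc => ?_) (fun t ht hu hc => ?_) hxy hyx
    · obtain rfl := hc.1.unique hs hG hr ha
      exact hlow t (hTsub ht) ⟨hl, rfl⟩
    · obtain rfl := hc.1.unique hs hG hr ha
      exact hup t (hTsub ht) ⟨hu, rfl⟩
  · obtain ⟨T, hTsub, hT, hxy, hyx⟩ := h _ (mem_auxGraph_edges he ha hb hab)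
    have hTH := hTsub.trans Set.sdiff_subset
    refine hT.twinlessLinked_lift hs hG hr hrs hx hy hTH (fun t ht => ?_)
      (fun t _ _ hc => hab ((ha.unique hs hG hr hc.1).trans (hc.2.unique hs hG hr hb)))
      (fun t _ _ hc => hab ((ha.unique hs hG hr hc.1).trans (hc.2.unique hs hG hr hb))) hxy hyx
    -- Copy `0` of the image of `e` is deleted, so no other copy `0` has `e` as a preimage; a copy
    -- `1` has two preimages, one of which differs from `e`.
    by_cases hi : t.2.2 = 0
    · obtain ⟨f, hf, f1, f2⟩ := exists_lift (hTH ht)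
      refine ⟨f, hf, ?_, f1, f2⟩
      rintro rfl
      refine (hTsub ht).2 ?_
      rw [ha.unique hs hG hr f1, hb.unique hs hG hr f2, ← hi]
      rfl
    · exact exists_lift_ne (hTH ht) hi e

end AuxGraph

end MultiDigraph

theorem mainTheorem5 {α β : Type*} (G : MultiDigraph α β)
    (hV : G.verts.Finite) (hE : G.edges.Finite) (hG : G.StronglyConnected)
    (s : α) (hs : s ∈ G.verts) (x y : α) (hx : x ∈ G.verts) (hy : y ∈ G.verts) :
    G.TwoEdgeTwinlessConnected x y ↔
      ∃ r ∈ G.verts, (r = s ∨ G.Marked s r) ∧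
        G.OrdinaryIn s r x ∧ G.OrdinaryIn s r y ∧
        (G.auxGraph s r).TwoEdgeTwinlessConnected x y := by
  have haux : ∀ r ∈ G.verts, _ := fun r hr =>
    MultiDigraph.twoEdgeTwinlessConnected_iff (G := G.auxGraph s r) (x := x) (y := y)
      (hV.subset (MultiDigraph.auxGraph_verts_subset hs hr))
      (MultiDigraph.auxGraph_edges_finite hV hs hr)
  rw [MultiDigraph.twoEdgeTwinlessConnected_iff hV hE]
  constructor
  · rintro ⟨-, -, h⟩
    obtain ⟨r, hr, hrs, hxr, hyr⟩ := MultiDigraph.exists_common_tree hV hs hG hx hy h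
    exact ⟨r, hr, hrs, hxr, hyr, (haux r hr).mpr ⟨Or.inl (Or.inl hxr), Or.inl (Or.inl hyr),
      fun t ht => MultiDigraph.twinlessLinked_auxGraph hV hs hG hr hrs hxr hyr h ht⟩⟩
  · rintro ⟨r, hr, hrs, hxr, hyr, h⟩
    exact ⟨hx, hy, fun e he => MultiDigraph.twinlessLinked_of_auxGraph hV hs hG hr hrs hxr hyr
      ((haux r hr).mp h).2.2 he⟩
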